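/- The tensor product of effect algebras does not in general preserve the Riesz decomposition property. Here an effect algebra is a set $E$ with elements $0,1$, a unary operation $'$ and a partial binary operation $\oplus$ that is commutative and associative (as Kleene identities: if one side is defined, so is the other, and they are equal), such that $a\oplus b=1$ if and only if $b=a'$, and $a\oplus 1$ is defined if and only if $a=0$, in which case $0\oplus 1=1$. A homomorphism of effect algebras is a map $f$ with $f(1)=1$ that preserves existing orthosums, i.e. whenever $a\oplus b$ is defined, $f(a)\oplus f(b)$ is defined and equals $f(a\oplus b)$. A bihomomorphism $\beta\colon E\times F\to G$ is a map such that all $\beta(a,-)$ and $\beta(-,b)$ preserve existing orthosums and $\beta(1,1)=1$. A tensor product of $E$ and $F$ is an effect algebra $E\otimes F$ with a bihomomorphism $\otimes\colon E\times F\to E\otimes F$ such that for every bihomomorphism $\beta\colon E\times F\to G$ there is a unique homomorphism $h\colon E\otimes F\to G$ with $\beta(a,b)=h(a\otimes b)$ for all $a\in E$, $b\in F$. An effect algebra has the Riesz decomposition property (RDP) if whenever $a_1\oplus a_2=b_1\oplus b_2$ (both sides defined), there are elements $c_{11},c_{12},c_{21},c_{22}$ with $a_i=c_{i1}\oplus c_{i2}$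 and $b_j=c_{1j}\oplus c_{2j}$ for $i,j\in\{1,2\}$. **Corollary.** There exist effect algebras $E$ and $F$, both with (RDP), such that a tensor product of $E$ and $F$ exists and no tensor product of $E$ and $F$ has (RDP). -/

import Mathlib

universe u

/-- An effect algebra: a set with constants `0`, `1`, a unary operation `orth` and a partial binary
operation `oplus`, where `oplus a b = none` means that `a ⊕ b` is undefined and `oplus a b = some c`
means that `a ⊕ b` is defined and equals `c`. -/
class EffectAlgebra (E : Type u) extends Zero E, One E where
  oplus : E → E → Option E
  orth : E → E
  /-- Commutativity, as a Kleene identity. -/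
  oplus_comm : ∀ a b : E, oplus a b = oplus b a
  /-- Associativity, as a Kleene identity: if one side is defined then so is the other, and the
  two are equal. -/
  oplus_assoc : ∀ a b c : E,
    ((oplus a b).bind fun x => oplus x c) = ((oplus b c).bind fun y => oplus a y)
  oplus_eq_one_iff : ∀ a b : E, oplus a b = some 1 ↔ b = orth a
  /-- `a ⊕ 1` is defined if and only if `a = 0`. -/
  oplus_one_defined_iff : ∀ a : E, (∃ c : E, oplus a 1 = some c) ↔ a = 0
  zero_oplus_one : oplus 0 1 = some 1

namespace EffectAlgebra

/-- The map `f` preserves existing orthosums: if `a ⊕ b` is defined, then `f a ⊕ f b` is defined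
and equal to `f (a ⊕ b)`. -/
def PreservesOrthosums {E F : Type u} [EffectAlgebra E] [EffectAlgebra F] (f : E → F) : Prop :=
  ∀ a b c : E, oplus a b = some c → oplus (f a) (f b) = some (f c)

/-- Homomorphisms of effect algebras. -/
def IsHom {E F : Type u} [EffectAlgebra E] [EffectAlgebra F] (f : E → F) : Prop :=
  PreservesOrthosums f ∧ f 1 = 1

/-- Bihomomorphisms of effect algebras. -/
def IsBihom {E F G : Type u} [EffectAlgebra E] [EffectAlgebra F] [EffectAlgebra G]
    (β : E → F → G) : Prop :=
  (∀ a : E, PreservesOrthosums fun b : F => β a b) ∧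
  (∀ b : F, PreservesOrthosums fun a : E => β a b) ∧
  (IsHom fun b : F => β 1 b) ∧
  (IsHom fun a : E => β a 1)

/-- The effect algebra `T` together with `τ : E × F → T` is a tensor product of `E` and `F` in the
category of effect algebras: `τ` is a universal bihomomorphism. -/
def IsTensorProduct {E F T : Type u} [EffectAlgebra E] [EffectAlgebra F] [EffectAlgebra T]
    (τ : E → F → T) : Prop :=
  IsBihom τ ∧
  ∀ (G : Type u) [EffectAlgebra G] (β : E → F → G), IsBihom β →
    ∃! h : T → G, IsHom h ∧ ∀ (a : E) (b : F), β a b = h (τ a b)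

/-- The Riesz decomposition property: any two decompositions `a₁ ⊕ a₂ = b₁ ⊕ b₂` of the same
element have a common refinement. -/
def HasRDP (E : Type u) [EffectAlgebra E] : Prop :=
  ∀ a₁ a₂ b₁ b₂ s : E, oplus a₁ a₂ = some s → oplus b₁ b₂ = some s →
    ∃ c₁₁ c₁₂ c₂₁ c₂₂ : E,
      oplus c₁₁ c₁₂ = some a₁ ∧ oplus c₂₁ c₂₂ = some a₂ ∧
      oplus c₁₁ c₂₁ = some b₁ ∧ oplus c₁₂ c₂₂ = some b₂

end EffectAlgebra

/-!
Two general constructions carry the proof.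

*Existence of tensor products.* Any two effect algebras have a tensor product, here
`EffectAlgebra.Tensor E F`. Its elements are formal terms built from symbols `a ⊗ b` by `⊕` and `'`
which are defined under every bihomomorphism out of `E × F`, two terms being identified when every
bihomomorphism gives them the same value. Since `Prop` is impredicative, the quantification over all
effect algebras of the universe does not raise the universe level of this quotient.

*Failure of refinement.* A refinement in a tensor product `T` of `E` and `F` is carried by the
homomorphism induced by a bihomomorphism `β : E × F → L` to a refinement in `L`. So it suffices to
find `e₁, e₂ ∈ E` and `f₀, f₁ ∈ F` such that `(e₁ ⊕ e₂) ⊗ f₀ = (e₁ ⊕ e₂) ⊗ f₁` holds in every tensor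
product, while the two decompositions `β e₁ f₀ ⊕ β e₂ f₀ = β e₁ f₁ ⊕ β e₂ f₁` have no common
refinement for a suitable `β`.

All algebras used are unit intervals of abelian groups `ℚ × A`, with unit `(1, 0)`, ordered by a
cone `C` on `A` and the lexicographic rule: `(q, a)` is positive if `q > 0`, or if `q = 0` and
`a ∈ C`. If `C` has refinement then so does this cone, because `ℚ` is dense
(`lexCone_hasRefinement`).

* For `F` take `A = ℤ/2` and `C = 0`, and let `f₀ = (1/2, 0)`, `f₁ = (1/2, 1)`; then
  `f₀ ⊕ f₀ = f₁ ⊕ f₁`, so `d ⊗ f₀ = d ⊗ f₁` whenever `d = r ⊕ r`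
  (`IsBihom.apply_double_eq`).
* For `E` take a free group `A` on `e₁` and `g`, put `e₂ = 2 g - e₁`, and let `C` be the cone of
  combinations `m e₁ + n e₂` with `m, n ∈ ℕ`. The element `e₁ + e₂ = 2 g` is not a double in `E`
  itself, as `g` is not positive, but it is a difference of two doubles,
  `2 (1/4, g) - 2 (1/4, 0)`. Tensor products being cancellative,
  `(e₁ ⊕ e₂) ⊗ f₀ = (e₁ ⊕ e₂) ⊗ f₁`.
* For `L` take `A = ℚ × ℚ × ℤ/2`, with `C` the set of `(x, y, s)` such that `x, y ≥ 0`, and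
  `s = 0` if `x = y = 0`. There is a bihomomorphism `β` to `L` sending `(eᵢ, fₜ)` to the infinitesimal
  with `i`-th rational coordinate `1/2`, the other one `0`, and `t` in `ℤ/2`. A common lower bound of
  `β e₁ f₀` and `β e₂ f₁` vanishes, and so does one of `β e₂ f₀` and `β e₁ f₁`; hence a common
  refinement would force `β e₁ f₀ = β e₁ f₁`.
-/

namespace EffectAlgebra

/-! ### Elementary properties of effect algebras -/

section Basic

variable {E F G : Type u} [EffectAlgebra E] [EffectAlgebra F] [EffectAlgebra G]

theorem orth_one : orth (1 : E) = 0 :=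
  ((oplus_eq_one_iff 1 0).1 (by rw [oplus_comm, zero_oplus_one])).symm

theorem oplus_right_cancel {a b c d : E} (ha : oplus a c = some d) (hb : oplus b c = some d) :
    a = b := by
  have hd : oplus d (orth d) = some 1 := (oplus_eq_one_iff _ _).2 rfl
  -- Both `a` and `b` are the orthosupplement of `c ⊕ d'`.
  have key : ∀ x : E, oplus x c = some d →
      ((oplus c (orth d)).bind fun y => oplus x y) = some 1 := by
    intro x hx
    rw [← oplus_assoc, hx]
    exact hd
  obtain ⟨y, hy, hay⟩ := Option.bind_eq_some_iff.1 (key a ha)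
  have hby := key b hb
  rw [hy] at hby
  change oplus b y = some 1 at hby
  rw [oplus_comm] at hay hby
  exact ((oplus_eq_one_iff _ _).1 hay).trans ((oplus_eq_one_iff _ _).1 hby).symm

theorem IsHom.map_orth {f : E → F} (hf : IsHom f) (a : E) : f (orth a) = orth (f a) := by
  have h := hf.1 a (orth a) 1 ((oplus_eq_one_iff _ _).2 rfl)
  rw [hf.2] at h
  exact (oplus_eq_one_iff _ _).1 h

theorem IsBihom.map_one_one {β : E → F → G} (hβ : IsBihom β) : β 1 1 = 1 :=
  hβ.2.2.1.2

/-- A bihomomorphism does not distinguish `f` and `g` with `2 f = 2 g` when its first argument is a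
double: `(2 r) ⊗ f = r ⊗ (2 f)`. -/
theorem IsBihom.apply_double_eq {β : E → F → G} (hβ : IsBihom β) {r d : E} {f g s : F}
    (hr : oplus r r = some d) (hf : oplus f f = some s) (hg : oplus g g = some s) :
    β d f = β d g := by
  have move : ∀ x : F, oplus x x = some s → β d x = β r s := fun x hx =>
    Option.some_injective _ ((hβ.2.1 x r r d hr).symm.trans (hβ.1 r x x s hx))
  rw [move f hf, move g hg]

end Basic

/-! ### Existence of tensor products -/

/-- Formal terms in the operations `⊕` and `'` over symbols `a ⊗ b`. -/
inductive TensorTerm (E F : Type u) : Type u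
  | tmul : E → F → TensorTerm E F
  | compl : TensorTerm E F → TensorTerm E F
  | add : TensorTerm E F → TensorTerm E F → TensorTerm E F

namespace TensorTerm

variable {E F G : Type u} [EffectAlgebra E] [EffectAlgebra F] [EffectAlgebra G]

/-- The value of a term when `a ⊗ b` is interpreted as `β a b`; it is `none` if some orthosum
occurring in the term is undefined. -/
def eval (β : E → F → G) : TensorTerm E F → Option G
  | tmul a b => some (β a b)
  | compl t => (eval β t).map orth
  | add s t => (eval β s).bind fun x => (eval β t).bind fun y => oplus x y

/-- A term is total if every bihomomorphism gives it a value. -/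
def Total (t : TensorTerm E F) : Prop :=
  ∀ (G : Type u) [EffectAlgebra G] (β : E → F → G), IsBihom β → ∃ x, eval β t = some x

theorem Total.of_compl {t : TensorTerm E F} (h : (compl t).Total) : t.Total := by
  intro G _ β hβ
  obtain ⟨x, hx⟩ := h G β hβ
  obtain ⟨y, hy, -⟩ := Option.map_eq_some_iff.1 hx
  exact ⟨y, hy⟩

theorem Total.of_add_left {s t : TensorTerm E F} (h : (add s t).Total) : s.Total := by
  intro G _ β hβ
  obtain ⟨x, hx⟩ := h G β hβ
  obtain ⟨y, hy, -⟩ := Option.bind_eq_some_iff.1 hx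
  exact ⟨y, hy⟩

theorem Total.of_add_right {s t : TensorTerm E F} (h : (add s t).Total) : t.Total := by
  intro G _ β hβ
  obtain ⟨x, hx⟩ := h G β hβ
  obtain ⟨y, -, hy⟩ := Option.bind_eq_some_iff.1 hx
  obtain ⟨z, hz, -⟩ := Option.bind_eq_some_iff.1 hy
  exact ⟨z, hz⟩

/-- Total terms are equivalent if every bihomomorphism gives them the same value. -/
def setoid (E F : Type u) [EffectAlgebra E] [EffectAlgebra F] :
    Setoid {t : TensorTerm E F // t.Total} where
  r s t := ∀ (G : Type u) [EffectAlgebra G] (β : E → F → G), IsBihom β →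
    eval β s.1 = eval β t.1
  iseqv :=
    ⟨fun _ _ _ _ _ => rfl, fun h G _ β hβ => (h G β hβ).symm,
      fun h k G _ β hβ => (h G β hβ).trans (k G β hβ)⟩

end TensorTerm

/-- The tensor product of two effect algebras: total terms modulo equality under all
bihomomorphisms. -/
def Tensor (E F : Type u) [EffectAlgebra E] [EffectAlgebra F] : Type u :=
  Quotient (TensorTerm.setoid E F)

namespace Tensor

open TensorTerm

variable {E F G : Type u} [EffectAlgebra E] [EffectAlgebra F] [EffectAlgebra G]

/-- The class of a total term. -/
def mk (t : TensorTerm E F) (ht : t.Total) : Tensor E F :=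
  Quotient.mk (TensorTerm.setoid E F) ⟨t, ht⟩

theorem exists_mk (x : Tensor E F) : ∃ t ht, x = mk t ht := by
  obtain ⟨⟨t, ht⟩, rfl⟩ := Quotient.exists_rep x
  exact ⟨t, ht, rfl⟩

/-- The map from the tensor product induced by a bihomomorphism. -/
noncomputable def lift (β : E → F → G) (hβ : IsBihom β) : Tensor E F → G :=
  Quotient.lift (fun t => (t.2 G β hβ).choose) fun s t h =>
    Option.some_injective _ <|
      ((s.2 G β hβ).choose_spec.symm.trans (h G β hβ)).trans (t.2 G β hβ).choose_spec

theorem eval_eq_lift_mk {β : E → F → G} (hβ : IsBihom β) (t : TensorTerm E F) (ht : t.Total) :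
    eval β t = some (lift β hβ (mk t ht)) :=
  (ht G β hβ).choose_spec

theorem ext {x y : Tensor E F}
    (h : ∀ (G : Type u) [EffectAlgebra G] (β : E → F → G) (hβ : IsBihom β),
      lift β hβ x = lift β hβ y) : x = y := by
  obtain ⟨s, hs, rfl⟩ := exists_mk x
  obtain ⟨t, ht, rfl⟩ := exists_mk y
  refine Quotient.sound fun G _ β hβ => ?_
  change eval β s = eval β t
  rw [eval_eq_lift_mk hβ s hs, eval_eq_lift_mk hβ t ht, h]

/-- Pure tensors. -/
def tmul (a : E) (b : F) : Tensor E F :=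
  mk (.tmul a b) fun _ _ β _ => ⟨β a b, rfl⟩

theorem lift_tmul {β : E → F → G} (hβ : IsBihom β) (a : E) (b : F) :
    lift β hβ (tmul a b) = β a b :=
  Option.some_injective _ (eval_eq_lift_mk hβ _ _).symm

theorem exists_orth (x : Tensor E F) :
    ∃ y : Tensor E F, ∀ (G : Type u) [EffectAlgebra G] (β : E → F → G) (hβ : IsBihom β),
      lift β hβ y = orth (lift β hβ x) := by
  obtain ⟨t, ht, rfl⟩ := exists_mk x
  have key : ∀ (G : Type u) [EffectAlgebra G] (β : E → F → G) (hβ : IsBihom β),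
      eval β (.compl t) = some (orth (lift β hβ (mk t ht))) := by
    intro G _ β hβ
    rw [eval, eval_eq_lift_mk hβ t ht, Option.map_some]
  refine ⟨mk (.compl t) fun G _ β hβ => ⟨_, key G β hβ⟩, fun G _ β hβ => ?_⟩
  exact Option.some_injective _ ((eval_eq_lift_mk hβ _ _).symm.trans (key G β hβ))

/-- `z` is the orthosum of `x` and `y` under every bihomomorphism. -/
def IsSum (x y z : Tensor E F) : Prop :=
  ∀ (G : Type u) [EffectAlgebra G] (β : E → F → G) (hβ : IsBihom β),
    oplus (lift β hβ x) (lift β hβ y) = some (lift β hβ z)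

theorem isSum_mk_add {s t : TensorTerm E F} (h : (TensorTerm.add s t).Total) :
    IsSum (mk s h.of_add_left) (mk t h.of_add_right) (mk (.add s t) h) := by
  intro G _ β hβ
  rw [← eval_eq_lift_mk hβ _ h, eval, eval_eq_lift_mk hβ s h.of_add_left,
    eval_eq_lift_mk hβ t h.of_add_right]
  rfl

theorem exists_isSum {x y : Tensor E F}
    (h : ∀ (G : Type u) [EffectAlgebra G] (β : E → F → G) (hβ : IsBihom β),
      ∃ c, oplus (lift β hβ x) (lift β hβ y) = some c) : ∃ z, IsSum x y z := by
  obtain ⟨s, hs, rfl⟩ := exists_mk x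
  obtain ⟨t, ht, rfl⟩ := exists_mk y
  have htot : (TensorTerm.add s t).Total := by
    intro G _ β hβ
    rw [eval, eval_eq_lift_mk hβ s hs, eval_eq_lift_mk hβ t ht]
    exact h G β hβ
  exact ⟨_, isSum_mk_add htot⟩

theorem IsSum.unique {x y z z' : Tensor E F} (h : IsSum x y z) (h' : IsSum x y z') : z = z' :=
  ext fun G _ β hβ => Option.some_injective _ ((h G β hβ).symm.trans (h' G β hβ))

open Classical in
/-- The partial sum of the tensor product, defined if it is so under every bihomomorphism. -/
noncomputable def partialAdd (x y : Tensor E F) : Option (Tensor E F) :=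
  if h : ∃ z, IsSum x y z then some h.choose else none

theorem partialAdd_eq_some {x y z : Tensor E F} : partialAdd x y = some z ↔ IsSum x y z := by
  unfold partialAdd
  split_ifs with h
  · rw [Option.some_inj]
    exact ⟨fun e => e ▸ h.choose_spec, fun hz => h.choose_spec.unique hz⟩
  · exact ⟨fun e => (nomatch e), fun hz => (h ⟨z, hz⟩).elim⟩

theorem partialAdd_comm (x y : Tensor E F) : partialAdd x y = partialAdd y x := by
  ext z
  rw [partialAdd_eq_some, partialAdd_eq_some]
  exact ⟨fun h G _ β hβ => oplus_comm (lift β hβ x) _ ▸ h G β hβ,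
    fun h G _ β hβ => oplus_comm (lift β hβ y) _ ▸ h G β hβ⟩

theorem exists_isSum_assoc {x y z p w : Tensor E F} (hp : IsSum x y p) (hw : IsSum p z w) :
    ∃ q, IsSum y z q ∧ IsSum x q w := by
  have key : ∀ (G : Type u) [EffectAlgebra G] (β : E → F → G) (hβ : IsBihom β),
      ∃ c, oplus (lift β hβ y) (lift β hβ z) = some c ∧
        oplus (lift β hβ x) c = some (lift β hβ w) := by
    intro G _ β hβ
    apply Option.bind_eq_some_iff.1
    rw [← oplus_assoc, hp G β hβ]
    exact hw G β hβ
  obtain ⟨q, hq⟩ := exists_isSum fun G _ β hβ => (key G β hβ).imp fun _ h => h.1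
  refine ⟨q, hq, fun G _ β hβ => ?_⟩
  obtain ⟨c, hc, hxc⟩ := key G β hβ
  rwa [← Option.some_injective _ (hc.symm.trans (hq G β hβ))]

theorem IsSum.symm {x y z : Tensor E F} (h : IsSum x y z) : IsSum y x z := by
  rw [← partialAdd_eq_some, partialAdd_comm, partialAdd_eq_some]
  exact h

instance : One (Tensor E F) := ⟨tmul 1 1⟩

noncomputable instance : Zero (Tensor E F) := ⟨(exists_orth 1).choose⟩

theorem lift_one {β : E → F → G} (hβ : IsBihom β) : lift β hβ 1 = 1 :=
  (lift_tmul hβ 1 1).trans hβ.map_one_one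

theorem lift_zero {β : E → F → G} (hβ : IsBihom β) : lift β hβ 0 = 0 := by
  have h := (exists_orth (1 : Tensor E F)).choose_spec G β hβ
  rwa [lift_one, orth_one] at h

theorem isSum_zero_one : IsSum (0 : Tensor E F) 1 1 := fun G _ β hβ => by
  rw [lift_zero, lift_one, zero_oplus_one]

noncomputable instance : EffectAlgebra (Tensor E F) where
  oplus := partialAdd
  orth x := (exists_orth x).choose
  oplus_comm := partialAdd_comm
  oplus_assoc x y z := by
    ext w
    simp only [Option.bind_eq_some_iff, partialAdd_eq_some]
    refine ⟨fun ⟨p, hp, hw⟩ => exists_isSum_assoc hp hw, fun ⟨q, hq, hw⟩ => ?_⟩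
    obtain ⟨p, hp, h⟩ := exists_isSum_assoc hq.symm hw.symm
    exact ⟨p, hp.symm, h.symm⟩
  oplus_eq_one_iff x y := by
    rw [partialAdd_eq_some]
    refine ⟨fun h => ext fun G _ β hβ => ?_, ?_⟩
    · rw [(exists_orth x).choose_spec, ← oplus_eq_one_iff, h G β hβ, lift_one]
    · rintro rfl G _ β hβ
      rw [(exists_orth x).choose_spec, lift_one, oplus_eq_one_iff]
  oplus_one_defined_iff x := by
    constructor
    · rintro ⟨c, hc⟩
      refine ext fun G _ β hβ => ?_
      have h := partialAdd_eq_some.1 hc G β hβ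
      rw [lift_one] at h
      rw [lift_zero]
      exact (oplus_one_defined_iff _).1 ⟨_, h⟩
    · rintro rfl
      exact ⟨1, partialAdd_eq_some.2 isSum_zero_one⟩
  zero_oplus_one := partialAdd_eq_some.2 isSum_zero_one

theorem oplus_eq_some {x y z : Tensor E F} : oplus x y = some z ↔ IsSum x y z :=
  partialAdd_eq_some

theorem isBihom_tmul : IsBihom (tmul : E → F → Tensor E F) := by
  have hl : ∀ a : E, PreservesOrthosums fun b : F => tmul a b := by
    intro a b c d h
    refine oplus_eq_some.2 fun G _ β hβ => ?_
    simp only [lift_tmul]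
    exact hβ.1 a b c d h
  have hr : ∀ b : F, PreservesOrthosums fun a : E => tmul a b := by
    intro b a c d h
    refine oplus_eq_some.2 fun G _ β hβ => ?_
    simp only [lift_tmul]
    exact hβ.2.1 b a c d h
  exact ⟨hl, hr, ⟨hl 1, rfl⟩, ⟨hr 1, rfl⟩⟩

theorem isHom_lift {β : E → F → G} (hβ : IsBihom β) : IsHom (lift β hβ) :=
  ⟨fun _ _ _ h => oplus_eq_some.1 h G β hβ, lift_one hβ⟩

/-- Pure tensors generate the tensor product. -/
theorem hom_ext {f g : Tensor E F → G} (hf : IsHom f) (hg : IsHom g)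
    (h : ∀ a b, f (tmul a b) = g (tmul a b)) : f = g := by
  have key : ∀ (t : TensorTerm E F) (ht : t.Total), f (mk t ht) = g (mk t ht) := by
    intro t
    induction t with
    | tmul a b => exact fun _ => h a b
    | compl t ih =>
      intro ht
      have e : mk (.compl t) ht = orth (mk t ht.of_compl) := by
        refine ext fun G _ β hβ => Option.some_injective _ ?_
        rw [← eval_eq_lift_mk, (isHom_lift hβ).map_orth, eval, eval_eq_lift_mk hβ t ht.of_compl,
          Option.map_some]
      rw [e, hf.map_orth, hg.map_orth, ih]
    | add s t ihs iht =>
      intro ht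
      have e := oplus_eq_some.2 (isSum_mk_add ht)
      have hf' := hf.1 _ _ _ e
      rw [ihs, iht] at hf'
      exact Option.some_injective _ (hf'.symm.trans (hg.1 _ _ _ e))
  funext x
  obtain ⟨t, ht, rfl⟩ := exists_mk x
  exact key t ht

theorem isTensorProduct_tmul : IsTensorProduct (tmul : E → F → Tensor E F) := by
  refine ⟨isBihom_tmul, fun G _ β hβ =>
    ⟨lift β hβ, ⟨isHom_lift hβ, fun a b => (lift_tmul hβ a b).symm⟩, ?_⟩⟩
  rintro g ⟨hg, hgβ⟩
  exact hom_ext hg (isHom_lift hβ) fun a b => by rw [← hgβ, lift_tmul]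

end Tensor

/-! ### Intervals in ordered groups -/

/-- The interval `[0, w]` of an abelian group with positive cone `C`, in an arbitrary universe. -/
structure ConeInterval {K : Type} [AddCommGroup K] (C : AddGroupCone K) (w : C) : Type u where
  val : K
  pos : val ∈ C
  le : (w : K) - val ∈ C

namespace ConeInterval

variable {K K₁ K₂ : Type} [AddCommGroup K] [AddCommGroup K₁] [AddCommGroup K₂]
  {C : AddGroupCone K} {C₁ : AddGroupCone K₁} {C₂ : AddGroupCone K₂} {w : C} {w₁ : C₁} {w₂ : C₂}

theorem ext {x y : ConeInterval.{u} C w} (h : x.val = y.val) : x = y := by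
  cases x; cases y; cases h; rfl

open Classical in
/-- The sum of two elements of the interval, defined if it lies in the interval. -/
noncomputable def partialAdd (x y : ConeInterval.{u} C w) : Option (ConeInterval.{u} C w) :=
  if h : (w : K) - (x.val + y.val) ∈ C then some ⟨x.val + y.val, add_mem x.pos y.pos, h⟩ else none

theorem partialAdd_eq_some {x y z : ConeInterval.{u} C w} :
    partialAdd x y = some z ↔ x.val + y.val = z.val := by
  unfold partialAdd
  split_ifs with h
  · rw [Option.some_inj]
    exact ⟨fun e => e ▸ rfl, fun e => ext e⟩
  · exact ⟨fun e => (nomatch e), fun e => (h (e ▸ z.le)).elim⟩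

noncomputable instance : EffectAlgebra (ConeInterval.{u} C w) where
  zero := ⟨0, zero_mem C, by simp⟩
  one := ⟨w, w.2, by simp [zero_mem C]⟩
  oplus := partialAdd
  orth x := ⟨w - x.val, x.le, by simpa using x.pos⟩
  oplus_comm x y := by
    ext z
    rw [partialAdd_eq_some, partialAdd_eq_some, add_comm]
  oplus_assoc x y z := by
    ext v
    simp only [Option.bind_eq_some_iff, partialAdd_eq_some]
    constructor
    · rintro ⟨p, hp, hv⟩
      rw [← hp] at hv
      have hle : (w : K) - (y.val + z.val) ∈ C := by
        have := add_mem v.le x.pos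
        rwa [← hv, show (w : K) - (x.val + y.val + z.val) + x.val = w - (y.val + z.val) by abel]
          at this
      exact ⟨⟨y.val + z.val, add_mem y.pos z.pos, hle⟩, rfl, by rw [← hv, add_assoc]⟩
    · rintro ⟨p, hp, hv⟩
      rw [← hp] at hv
      have hle : (w : K) - (x.val + y.val) ∈ C := by
        have := add_mem v.le z.pos
        rwa [← hv, show (w : K) - (x.val + (y.val + z.val)) + z.val = w - (x.val + y.val) by abel]
          at this
      exact ⟨⟨x.val + y.val, add_mem x.pos y.pos, hle⟩, rfl, by rw [← hv, add_assoc]⟩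
  oplus_eq_one_iff x y := by
    rw [partialAdd_eq_some]
    exact ⟨fun h => ext (eq_sub_of_add_eq' h), fun h => h ▸ add_sub_cancel _ _⟩
  oplus_one_defined_iff x := by
    constructor
    · rintro ⟨c, hc⟩
      have h : x.val + (w : K) = c.val := partialAdd_eq_some.1 hc
      have hneg : -x.val ∈ C := by
        have := c.le
        rwa [← h, show (w : K) - (x.val + w) = -x.val by abel] at this
      exact ext (eq_zero_of_mem_of_neg_mem x.pos hneg)
    · rintro rfl
      exact ⟨_, partialAdd_eq_some.2 (zero_add _)⟩
  zero_oplus_one := partialAdd_eq_some.2 (zero_add _)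

theorem oplus_eq_some {x y z : ConeInterval.{u} C w} :
    oplus x y = some z ↔ x.val + y.val = z.val :=
  partialAdd_eq_some

theorem sub_left_mem {x y z : K} (h : (w : K) - z ∈ C) (hz : x + y = z) (hy : y ∈ C) :
    (w : K) - x ∈ C := by
  have := add_mem h hy
  rwa [← hz, show (w : K) - (x + y) + y = w - x by abel] at this

/-- Refinement in a positive cone `C`. -/
def _root_.AddGroupCone.HasRefinement (C : AddGroupCone K) : Prop :=
  ∀ a₁ ∈ C, ∀ a₂ ∈ C, ∀ b₁ ∈ C, ∀ b₂ ∈ C, a₁ + a₂ = b₁ + b₂ →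
    ∃ c₁₁ ∈ C, ∃ c₁₂ ∈ C, ∃ c₂₁ ∈ C, ∃ c₂₂ ∈ C,
      c₁₁ + c₁₂ = a₁ ∧ c₂₁ + c₂₂ = a₂ ∧ c₁₁ + c₂₁ = b₁ ∧ c₁₂ + c₂₂ = b₂

theorem hasRDP (hC : C.HasRefinement) : HasRDP (ConeInterval.{u} C w) := by
  intro a₁ a₂ b₁ b₂ s ha hb
  rw [oplus_eq_some] at ha hb
  obtain ⟨c₁₁, h₁₁, c₁₂, h₁₂, c₂₁, h₂₁, c₂₂, h₂₂, e₁, e₂, e₃, e₄⟩ :=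
    hC _ a₁.pos _ a₂.pos _ b₁.pos _ b₂.pos (ha.trans hb.symm)
  refine ⟨⟨c₁₁, h₁₁, sub_left_mem a₁.le e₁ h₁₂⟩,
    ⟨c₁₂, h₁₂, sub_left_mem b₂.le e₄ h₂₂⟩,
    ⟨c₂₁, h₂₁, sub_left_mem a₂.le e₂ h₂₂⟩,
    ⟨c₂₂, h₂₂, sub_left_mem a₂.le (add_comm c₂₂ c₂₁ ▸ e₂) h₂₁⟩, ?_⟩
  simp only [oplus_eq_some]
  exact ⟨e₁, e₂, e₃, e₄⟩

/-- A positive unital biadditive map of ordered groups restricted to intervals. Its values lie below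
the unit since `w₁ ⊗ w₂ - x ⊗ y = (w₁ - x) ⊗ w₂ + x ⊗ (w₂ - y)`. -/
def biadd (B : K₁ →+ K₂ →+ K) (hB : ∀ x ∈ C₁, ∀ y ∈ C₂, B x y ∈ C) (hw : B w₁ w₂ = w)
    (x : ConeInterval.{u} C₁ w₁) (y : ConeInterval.{u} C₂ w₂) : ConeInterval.{u} C w where
  val := B x.val y.val
  pos := hB _ x.pos _ y.pos
  le := by
    have h := add_mem (hB _ x.le _ w₂.2) (hB _ x.pos _ y.le)
    simpa [hw] using h

theorem isBihom_biadd (B : K₁ →+ K₂ →+ K) (hB : ∀ x ∈ C₁, ∀ y ∈ C₂, B x y ∈ C)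
    (hw : B w₁ w₂ = w) : IsBihom (biadd.{u} B hB hw) := by
  have hl : ∀ a, PreservesOrthosums fun b => biadd.{u} B hB hw a b := by
    intro a b c d h
    rw [oplus_eq_some] at h ⊢
    change B _ _ + B _ _ = B _ _
    rw [← h, map_add]
  have hr : ∀ b, PreservesOrthosums fun a => biadd.{u} B hB hw a b := by
    intro b a c d h
    rw [oplus_eq_some] at h ⊢
    change B _ _ + B _ _ = B _ _
    rw [← h, map_add, AddMonoidHom.add_apply]
  exact ⟨hl, hr, ⟨hl 1, ext hw⟩, ⟨hr 1, ext hw⟩⟩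

end ConeInterval

/-! ### Lexicographic cones -/

section Lex

variable {A : Type} [AddCommGroup A]

/-- The cone on `ℚ × A` ordered lexicographically, the second factor being ordered by `C`. -/
def lexCone (C : AddGroupCone A) : AddGroupCone (ℚ × A) where
  carrier := {x | 0 < x.1 ∨ x.1 = 0 ∧ x.2 ∈ C}
  zero_mem' := Or.inr ⟨rfl, zero_mem C⟩
  add_mem' := by
    rintro ⟨p, a⟩ ⟨q, b⟩ (h | ⟨h, ha⟩) (k | ⟨k, hb⟩) <;>
      simp only [Set.mem_ofPred_eq, Prod.mk_add_mk] at *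
    · exact Or.inl (add_pos h k)
    · exact Or.inl (by rwa [k, add_zero])
    · exact Or.inl (by rwa [h, zero_add])
    · exact Or.inr ⟨by rw [h, k, add_zero], add_mem ha hb⟩
  eq_zero_of_mem_of_neg_mem' := by
    rintro ⟨p, a⟩ (h | ⟨h, ha⟩) (k | ⟨k, hb⟩) <;> simp only [Prod.neg_mk] at *
    · linarith
    · linarith
    · linarith
    · exact Prod.ext h (eq_zero_of_mem_of_neg_mem ha hb)

theorem mem_lexCone {C : AddGroupCone A} {x : ℚ × A} :
    x ∈ lexCone C ↔ 0 < x.1 ∨ x.1 = 0 ∧ x.2 ∈ C :=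
  Iff.rfl

/-- The unit `(1, 0)`. -/
def lexUnit (C : AddGroupCone A) : lexCone C :=
  ⟨(1, 0), Or.inl one_pos⟩

/-- If all four summands have positive first coordinate, density of `ℚ` gives a refinement with
positive first coordinates, and then the second coordinates are unconstrained. Otherwise some
summand is infinitesimal and may be subtracted from any summand that is not. -/
theorem lexCone_hasRefinement {C : AddGroupCone A} (hC : C.HasRefinement) :
    (lexCone C).HasRefinement := by
  have sub_mem : ∀ {x y : ℚ × A}, 0 < x.1 → y.1 = 0 → x - y ∈ lexCone C := fun {x y} hx hy =>
    Or.inl (by rwa [Prod.fst_sub, hy, sub_zero])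
  rintro a₁ ha₁ a₂ ha₂ b₁ hb₁ b₂ hb₂ h
  have h₁ : a₁.1 + a₂.1 = b₁.1 + b₂.1 := congrArg Prod.fst h
  have h₂ : a₁.2 + a₂.2 = b₁.2 + b₂.2 := congrArg Prod.snd h
  have z : (0 : ℚ × A) ∈ lexCone C := zero_mem _
  rcases id ha₁ with pa₁ | ⟨qa₁, ia₁⟩
  · rcases id ha₂ with pa₂ | ⟨qa₂, ia₂⟩
    · rcases id hb₁ with pb₁ | ⟨qb₁, ib₁⟩
      · rcases id hb₂ with pb₂ | ⟨qb₂, ib₂⟩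
        · -- The open interval from `max 0 (a₁ - b₂)` to `min a₁ b₁` is nonempty.
          obtain ⟨q, hq, hq'⟩ : ∃ q, max 0 (a₁.1 - b₂.1) < q ∧ q < min a₁.1 b₁.1 :=
            exists_between (by
              rw [max_lt_iff, lt_min_iff, lt_min_iff]
              exact ⟨⟨pa₁, pb₁⟩, by linarith, by linarith⟩)
          rw [max_lt_iff] at hq
          rw [lt_min_iff] at hq'
          refine ⟨(q, 0), Or.inl hq.1, a₁ - (q, 0), Or.inl (sub_pos.2 hq'.1), b₁ - (q, 0),
            Or.inl (sub_pos.2 hq'.2), b₂ - (a₁ - (q, 0)), Or.inl ?_, by abel, ?_, by abel,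
            by abel⟩
          · change 0 < b₂.1 - (a₁.1 - q)
            linarith
          · rw [eq_sub_of_add_eq' h]
            abel
        · exact ⟨a₁ - b₂, sub_mem pa₁ qb₂, b₂, hb₂, a₂, ha₂, 0, z, by abel, by abel,
            by rw [sub_add_eq_add_sub, h]; abel, by abel⟩
      · exact ⟨b₁, hb₁, a₁ - b₁, sub_mem pa₁ qb₁, 0, z, a₂, ha₂, by abel, by abel, by abel,
          by rw [sub_add_eq_add_sub, h]; abel⟩
    · rcases id hb₁ with pb₁ | ⟨qb₁, ib₁⟩
      · exact ⟨b₁ - a₂, sub_mem pb₁ qa₂, b₂, hb₂, a₂, ha₂, 0, z,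
          by rw [sub_add_eq_add_sub, ← h]; abel, by abel, by abel, by abel⟩
      · exact ⟨b₁, hb₁, a₁ - b₁, sub_mem pa₁ qb₁, 0, z, a₂, ha₂, by abel, by abel, by abel,
          by rw [sub_add_eq_add_sub, h]; abel⟩
  · rcases id hb₁ with pb₁ | ⟨qb₁, ib₁⟩
    · exact ⟨a₁, ha₁, 0, z, b₁ - a₁, sub_mem pb₁ qa₁, b₂, hb₂, by abel,
        by rw [sub_add_eq_add_sub, ← h]; abel, by abel, by abel⟩
    · rcases id ha₂ with pa₂ | ⟨qa₂, ia₂⟩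
      · exact ⟨0, z, a₁, ha₁, b₁, hb₁, a₂ - b₁, sub_mem pa₂ qb₁, by abel, by abel, by abel,
          by rw [← add_sub_assoc, h]; abel⟩
      · have qb₂ : b₂.1 = 0 := by linarith
        have ib₂ : b₂.2 ∈ C := hb₂.elim (fun p => absurd p (by rw [qb₂]; exact lt_irrefl _))
          fun p => p.2
        obtain ⟨c₁₁, m₁₁, c₁₂, m₁₂, c₂₁, m₂₁, c₂₂, m₂₂, e₁, e₂, e₃, e₄⟩ :=
          hC _ ia₁ _ ia₂ _ ib₁ _ ib₂ h₂
        exact ⟨(0, c₁₁), Or.inr ⟨rfl, m₁₁⟩, (0, c₁₂), Or.inr ⟨rfl, m₁₂⟩, (0, c₂₁),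
          Or.inr ⟨rfl, m₂₁⟩, (0, c₂₂), Or.inr ⟨rfl, m₂₂⟩,
          Prod.ext (by simp [qa₁]) e₁, Prod.ext (by simp [qa₂]) e₂,
          Prod.ext (by simp [qb₁]) e₃, Prod.ext (by simp [qb₂]) e₄⟩

end Lex

/-! ### The two factors -/

/-- The cone of a trivially ordered group. -/
def trivialCone (A : Type) [AddCommGroup A] : AddGroupCone A where
  carrier := {0}
  zero_mem' := rfl
  add_mem' := by rintro _ _ rfl rfl; exact add_zero 0
  eq_zero_of_mem_of_neg_mem' h _ := h

theorem trivialCone_hasRefinement (A : Type) [AddCommGroup A] :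
    (trivialCone A).HasRefinement := by
  rintro _ rfl _ rfl _ rfl _ rfl -
  exact ⟨0, rfl, 0, rfl, 0, rfl, 0, rfl, by simp⟩

/-- In `ℤ × ℤ`, whose basis vectors are called `e₁` and `g`, the cone freely generated by `e₁` and
`e₂ = 2 g - e₁`. -/
def halfCone : AddGroupCone (ℤ × ℤ) where
  carrier := {x | ∃ m n : ℕ, x = ((m : ℤ) - n, 2 * (n : ℤ))}
  zero_mem' := ⟨0, 0, rfl⟩
  add_mem' := by
    rintro _ _ ⟨m, n, rfl⟩ ⟨m', n', rfl⟩
    refine ⟨m + m', n + n', ?_⟩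
    ext <;> push_cast <;> simp only [Prod.fst_add, Prod.snd_add] <;> ring
  eq_zero_of_mem_of_neg_mem' := by
    rintro _ ⟨m, n, rfl⟩ ⟨m', n', h⟩
    simp only [Prod.neg_mk, Prod.mk.injEq] at h
    exact Prod.ext (by change (m : ℤ) - n = 0; omega) (by change 2 * (n : ℤ) = 0; omega)

theorem nat_refinement {a₁ a₂ b₁ b₂ : ℕ} (h : a₁ + a₂ = b₁ + b₂) :
    ∃ c₁₁ c₁₂ c₂₁ c₂₂ : ℕ,
      c₁₁ + c₁₂ = a₁ ∧ c₂₁ + c₂₂ = a₂ ∧ c₁₁ + c₂₁ = b₁ ∧ c₁₂ + c₂₂ = b₂ :=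
  ⟨min a₁ b₁, a₁ - min a₁ b₁, b₁ - min a₁ b₁, a₂ - (b₁ - min a₁ b₁), by omega, by omega, by omega,
    by omega⟩

theorem halfCone_hasRefinement : halfCone.HasRefinement := by
  rintro _ ⟨m₁, n₁, rfl⟩ _ ⟨m₂, n₂, rfl⟩ _ ⟨k₁, l₁, rfl⟩ _ ⟨k₂, l₂, rfl⟩ h
  simp only [Prod.mk_add_mk, Prod.mk.injEq] at h
  obtain ⟨c₁₁, c₁₂, c₂₁, c₂₂, c⟩ := nat_refinement (show m₁ + m₂ = k₁ + k₂ by omega)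
  obtain ⟨d₁₁, d₁₂, d₂₁, d₂₂, d⟩ := nat_refinement (show n₁ + n₂ = l₁ + l₂ by omega)
  refine ⟨_, ⟨c₁₁, d₁₁, rfl⟩, _, ⟨c₁₂, d₁₂, rfl⟩, _, ⟨c₂₁, d₂₁, rfl⟩, _, ⟨c₂₂, d₂₂, rfl⟩, ?_⟩
  simp only [Prod.mk_add_mk, Prod.mk.injEq]
  omega

/-- The factor `E`: the unit interval of `ℚ × ℤ²`, ordered lexicographically by `halfCone`. -/
abbrev HalfInterval : Type u :=
  ConeInterval.{u} (lexCone halfCone) (lexUnit halfCone)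

/-- The factor `F`: the unit interval of `ℚ × ℤ/2`, where `(q, t)` is positive if `q > 0` or
`(q, t) = 0`. -/
abbrev TorsionInterval : Type u :=
  ConeInterval.{u} (lexCone (trivialCone (ZMod 2))) (lexUnit (trivialCone (ZMod 2)))

/-- The positive infinitesimal `m e₁ + n e₂`. -/
def infinitesimal (m n : ℕ) : HalfInterval.{u} where
  val := (0, ((m : ℤ) - n, 2 * (n : ℤ)))
  pos := Or.inr ⟨rfl, m, n, rfl⟩
  le := Or.inl (by simp [lexUnit])

/-- The element `(q, a)` for `0 < q < 1`. -/
def finitePart (q : ℚ) (h₀ : 0 < q) (h₁ : q < 1) (a : ℤ × ℤ) : HalfInterval.{u} where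
  val := (q, a)
  pos := Or.inl h₀
  le := Or.inl (by simpa [lexUnit] using h₁)

/-- The element `(1/2, t)`. -/
def halfTorsion (t : ZMod 2) : TorsionInterval.{u} where
  val := (1 / 2, t)
  pos := Or.inl (by norm_num)
  le := Or.inl (by norm_num [lexUnit])

theorem oplus_halfTorsion (t : ZMod 2) :
    oplus (halfTorsion.{u} t) (halfTorsion t) = some 1 := by
  refine ConeInterval.oplus_eq_some.2 (Prod.ext ?_ (CharTwo.add_self_eq_zero t))
  change (1 / 2 : ℚ) + 1 / 2 = 1
  norm_num

/-- `e₁ + e₂ = 2 (1/4, g) - 2 (1/4, 0)` is a difference of doubles, so a bihomomorphism takes the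
same value at `(e₁ ⊕ e₂, f₀)` and at `(e₁ ⊕ e₂, f₁)`. -/
theorem IsBihom.apply_infinitesimal_eq {T : Type u} [EffectAlgebra T]
    {τ : HalfInterval.{u} → TorsionInterval.{u} → T} (hτ : IsBihom τ) (s t : ZMod 2) :
    τ (infinitesimal 1 1) (halfTorsion s) = τ (infinitesimal 1 1) (halfTorsion t) := by
  let p : HalfInterval.{u} := finitePart (1 / 4) (by norm_num) (by norm_num) 0
  let r : HalfInterval.{u} := finitePart (1 / 4) (by norm_num) (by norm_num) (0, 1)
  let pp : HalfInterval.{u} := finitePart (1 / 2) (by norm_num) (by norm_num) 0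
  let rr : HalfInterval.{u} := finitePart (1 / 2) (by norm_num) (by norm_num) (0, 2)
  have hp : oplus p p = some pp := ConeInterval.oplus_eq_some.2 <|
    Prod.ext (show (1 / 4 : ℚ) + 1 / 4 = 1 / 2 by norm_num) (add_zero 0)
  have hr : oplus r r = some rr := ConeInterval.oplus_eq_some.2 <|
    Prod.ext (show (1 / 4 : ℚ) + 1 / 4 = 1 / 2 by norm_num) rfl
  have hd : oplus (infinitesimal 1 1) pp = some rr := ConeInterval.oplus_eq_some.2 <|
    Prod.ext (zero_add _) rfl
  have hs := hτ.2.1 (halfTorsion s) _ _ _ hd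
  have ht := hτ.2.1 (halfTorsion t) _ _ _ hd
  simp only at hs ht
  rw [hτ.apply_double_eq hp (oplus_halfTorsion s) (oplus_halfTorsion t),
    hτ.apply_double_eq hr (oplus_halfTorsion s) (oplus_halfTorsion t)] at hs
  exact oplus_right_cancel hs ht

/-! ### A bihomomorphism obstructing refinement -/

/-- On `ℚ × ℚ × ℤ/2`, the cone of all `(x, y, s)` with `x, y ≥ 0` and such that `s = 0` whenever
`x = y = 0`. -/
def obstructionCone : AddGroupCone (ℚ × ℚ × ZMod 2) where
  carrier := {x | 0 ≤ x.1 ∧ 0 ≤ x.2.1 ∧ (x.1 = 0 → x.2.1 = 0 → x.2.2 = 0)}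
  zero_mem' := ⟨le_rfl, le_rfl, fun _ _ => rfl⟩
  add_mem' := by
    rintro ⟨x, y, s⟩ ⟨x', y', s'⟩ ⟨hx, hy, hs⟩ ⟨hx', hy', hs'⟩
    simp only [Set.mem_ofPred_eq, Prod.mk_add_mk] at *
    refine ⟨add_nonneg hx hx', add_nonneg hy hy', fun e e' => ?_⟩
    rw [hs (by linarith) (by linarith), hs' (by linarith) (by linarith), add_zero]
  eq_zero_of_mem_of_neg_mem' := by
    rintro ⟨x, y, s⟩ ⟨hx, hy, hs⟩ ⟨hx', hy', -⟩
    simp only [Prod.neg_mk] at *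
    have ex : x = 0 := by linarith
    have ey : y = 0 := by linarith
    rw [hs ex ey, ex, ey]
    rfl

/-- The unit interval of `ℚ × ℚ × ℚ × ℤ/2`, ordered lexicographically by `obstructionCone`. -/
abbrev ObstructionInterval : Type u :=
  ConeInterval.{u} (lexCone obstructionCone) (lexUnit obstructionCone)

/-- The biadditive map `(q, a e₁ + b g) ⊗ (r, t) ↦ (q r, (a + b / 2) r, (b / 2) r, a t)`; here
`a + b / 2` and `b / 2` are the coordinates with respect to `e₁` and `e₂ = 2 g - e₁`. -/
def obstructionMap : (ℚ × ℤ × ℤ) →+ (ℚ × ZMod 2) →+ (ℚ × ℚ × ℚ × ZMod 2) :=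
  AddMonoidHom.mk'
    (fun x => AddMonoidHom.mk'
      (fun y => (x.1 * y.1, (x.2.1 + x.2.2 / 2) * y.1, x.2.2 / 2 * y.1, x.2.1 * y.2))
      fun y y' => by ext <;> simp <;> ring)
    fun x x' => by ext y <;> simp <;> ring

theorem obstructionMap_apply (q : ℚ) (a b : ℤ) (r : ℚ) (t : ZMod 2) :
    obstructionMap (q, a, b) (r, t) = (q * r, (a + b / 2) * r, b / 2 * r, a * t) :=
  rfl

theorem obstructionMap_mem : ∀ x ∈ lexCone halfCone, ∀ y ∈ lexCone (trivialCone (ZMod 2)),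
    obstructionMap x y ∈ lexCone obstructionCone := by
  rintro ⟨q, a, b⟩ hx ⟨r, t⟩ (hr | ⟨hr, ht⟩)
  · rcases hx with hq | ⟨hq, m, n, h⟩
    · exact Or.inl (mul_pos hq hr)
    · simp only [Prod.mk.injEq] at hq h hr
      obtain ⟨rfl, rfl⟩ := h
      have hm : ((m - n : ℤ) : ℚ) + ((2 * n : ℤ) : ℚ) / 2 = m := by push_cast; ring
      have hn : ((2 * n : ℤ) : ℚ) / 2 = n := by push_cast; ring
      rw [obstructionMap_apply, hm, hn, hq]
      refine Or.inr ⟨zero_mul _, by positivity, by positivity, fun e e' => ?_⟩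
      simp only [mul_eq_zero, hr.ne', or_false, Nat.cast_eq_zero] at e e'
      simp [e, e']
  · simp only at hr
    rw [show t = 0 from ht, hr, show ((0 : ℚ), (0 : ZMod 2)) = 0 from rfl, map_zero]
    exact zero_mem _

/-- The bihomomorphism of intervals given by `obstructionMap`. -/
def obstruction : HalfInterval.{u} → TorsionInterval.{u} → ObstructionInterval.{u} :=
  ConeInterval.biadd obstructionMap obstructionMap_mem
    (show obstructionMap (1, 0, 0) (1, 0) = (1, 0, 0, 0) by simp [obstructionMap_apply])

theorem isBihom_obstruction : IsBihom obstruction.{u} :=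
  ConeInterval.isBihom_biadd _ _ _

/-- Elements of the lexicographic `obstructionCone` whose sums with further positive elements are
`(0, x, 0, s)` and `(0, 0, y, t)` vanish. -/
theorem eq_zero_of_le_of_le {c d d' : ℚ × ℚ × ℚ × ZMod 2} {x y : ℚ} {s t : ZMod 2}
    (hc : c ∈ lexCone obstructionCone) (hd : d ∈ lexCone obstructionCone)
    (hd' : d' ∈ lexCone obstructionCone) (h : c + d = (0, x, 0, s)) (h' : c + d' = (0, 0, y, t)) :
    c = 0 := by
  obtain ⟨c₀, c₁, c₂, c₃⟩ := c
  obtain ⟨d₀, d₁, d₂, d₃⟩ := d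
  obtain ⟨d₀', d₁', d₂', d₃'⟩ := d'
  simp only [mem_lexCone] at hc hd hd'
  simp only [Prod.mk_add_mk, Prod.mk.injEq] at h h'
  have nonneg : ∀ {z : ℚ} {P : Prop}, 0 < z ∨ z = 0 ∧ P → 0 ≤ z := fun h =>
    h.elim le_of_lt fun h => h.1.ge
  have n := nonneg hc
  have m := nonneg hd
  have m' := nonneg hd'
  obtain ⟨ec, hc₁, hc₂, hc₃⟩ := hc.resolve_left (by linarith [h.1])
  obtain ⟨-, hd₁, hd₂, -⟩ := hd.resolve_left (by linarith [h.1])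
  obtain ⟨-, hd₁', hd₂', -⟩ := hd'.resolve_left (by linarith [h'.1])
  simp only at hc₁ hc₂ hc₃ hd₁ hd₂ hd₁' hd₂'
  have e₁ : c₁ = 0 := by linarith [h'.2.1]
  have e₂ : c₂ = 0 := by linarith [h.2.2.1]
  rw [hc₃ e₁ e₂, ec, e₁, e₂]
  rfl

theorem not_refinement_obstruction :
    ¬ ∃ c₁₁ c₁₂ c₂₁ c₂₂ : ObstructionInterval.{u},
      oplus c₁₁ c₁₂ = some (obstruction (infinitesimal 1 0) (halfTorsion 0)) ∧
      oplus c₂₁ c₂₂ = some (obstruction (infinitesimal 0 1) (halfTorsion 0)) ∧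
      oplus c₁₁ c₂₁ = some (obstruction (infinitesimal 1 0) (halfTorsion 1)) ∧
      oplus c₁₂ c₂₂ = some (obstruction (infinitesimal 0 1) (halfTorsion 1)) := by
  rintro ⟨c₁₁, c₁₂, c₂₁, c₂₂, h₁, h₂, h₃, h₄⟩
  rw [ConeInterval.oplus_eq_some] at h₁ h₂ h₃ h₄
  have v₁ : ∀ t, (obstruction.{u} (infinitesimal 1 0) (halfTorsion t)).val = (0, 1 / 2, 0, t) := by
    intro t
    refine (obstructionMap_apply _ _ _ _ _).trans ?_
    simp
  have v₂ : ∀ t, (obstruction.{u} (infinitesimal 0 1) (halfTorsion t)).val = (0, 0, 1 / 2, -t) := by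
    intro t
    refine (obstructionMap_apply _ _ _ _ _).trans ?_
    simp
  rw [v₁] at h₁ h₃
  rw [v₂] at h₂ h₄
  have z₁₂ : c₁₂.val = 0 :=
    eq_zero_of_le_of_le c₁₂.pos c₁₁.pos c₂₂.pos (add_comm c₁₁.val _ ▸ h₁) h₄
  have z₂₁ : c₂₁.val = 0 :=
    eq_zero_of_le_of_le c₂₁.pos c₁₁.pos c₂₂.pos (add_comm c₁₁.val _ ▸ h₃) h₂
  rw [z₁₂, add_zero] at h₁
  rw [z₂₁, add_zero, h₁] at h₃
  simp at h₃

theorem not_hasRDP_of_isTensorProduct {T : Type u} [EffectAlgebra T]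
    {τ : HalfInterval.{u} → TorsionInterval.{u} → T} (hτ : IsTensorProduct τ) : ¬ HasRDP T := by
  intro hT
  have he : oplus (infinitesimal.{u} 1 0) (infinitesimal 0 1) = some (infinitesimal 1 1) :=
    ConeInterval.oplus_eq_some.2 (Prod.ext (add_zero 0) rfl)
  have h₀ := hτ.1.2.1 (halfTorsion 0) _ _ _ he
  have h₁ := hτ.1.2.1 (halfTorsion 1) _ _ _ he
  simp only at h₀ h₁
  rw [hτ.1.apply_infinitesimal_eq 1 0] at h₁
  obtain ⟨c₁₁, c₁₂, c₂₁, c₂₂, e₁, e₂, e₃, e₄⟩ := hT _ _ _ _ _ h₀ h₁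
  obtain ⟨h, ⟨hh, hβ⟩, -⟩ := hτ.2 _ obstruction isBihom_obstruction
  refine not_refinement_obstruction.{u} ⟨h c₁₁, h c₁₂, h c₂₁, h c₂₂, ?_⟩
  simp only [hβ]
  exact ⟨hh.1 _ _ _ e₁, hh.1 _ _ _ e₂, hh.1 _ _ _ e₃, hh.1 _ _ _ e₄⟩

end EffectAlgebra

theorem mainTheorem2 :
    ∃ (E F : Type u) (_ : EffectAlgebra E) (_ : EffectAlgebra F),
      EffectAlgebra.HasRDP E ∧ EffectAlgebra.HasRDP F ∧
      (∃ (T : Type u) (_ : EffectAlgebra T) (τ : E → F → T),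
        EffectAlgebra.IsTensorProduct τ) ∧
      ∀ (T : Type u) (_ : EffectAlgebra T) (τ : E → F → T),
        EffectAlgebra.IsTensorProduct τ → ¬ EffectAlgebra.HasRDP T := by
  exact ⟨EffectAlgebra.HalfInterval, EffectAlgebra.TorsionInterval, inferInstance, inferInstance,
    EffectAlgebra.ConeInterval.hasRDP
      (EffectAlgebra.lexCone_hasRefinement EffectAlgebra.halfCone_hasRefinement),
    EffectAlgebra.ConeInterval.hasRDP
      (EffectAlgebra.lexCone_hasRefinement (EffectAlgebra.trivialCone_hasRefinement (ZMod 2))),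
    ⟨_, inferInstance, EffectAlgebra.Tensor.tmul, EffectAlgebra.Tensor.isTensorProduct_tmul⟩,
    fun _ _ _ hτ => EffectAlgebra.not_hasRDP_of_isTensorProduct hτ⟩
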